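/- Let $m,p\ge 0$ be integers with $m>p+2$, let $V>0$ be known and $A\ge 0$, let $X$ be a real $m\times p$ matrix of rank $p$ with rows $\mathbf{x}_1^T,\dots,\mathbf{x}_m^T$, and let $\beta\in\mathbb{R}^p$. Suppose that the random vectors $\theta=(\theta_1,\dots,\theta_m)^T$ and $\mathbf{y}=(y_1,\dots,y_m)^T$ are such that the $\theta_i$ are independent with $\theta_i\sim N(\mathbf{x}_i^T\beta,A)$ and, conditionally on $\theta$, the $y_i$ are independent with $y_i\sim N(\theta_i,V)$. Put $$B=\frac{V}{V+A},\qquad \hat\beta=(X^TX)^{-1}X^T\mathbf{y},\qquad S=\|\mathbf{y}-X\hat\beta\|^2,\qquad \hat B=\frac{V(m-p-2)}{S},$$ let $h_{ii}=\mathbf{x}_i^T(X^TX)^{-1}\mathbf{x}_i$, and let $\hat\theta^{EB}=(1-\hat B)\,\mathbf{y}+\hat B\,X\hat\beta$ be the empirical Bayes (James–Stein) estimator of $\theta$. Then, with expectations taken over the joint distribution of $(\theta,\mathbf{y})$ (and all of them finite): (a) for every $i=1,\dots,m$, $$E\big[(\theta_i-\hat\theta_i^{EB})^2\big]=V(1-B)+VB\,h_{ii}+\frac{2VB(1-h_{ii})}{m-p};$$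 (b) $E\,\|\theta-\hat\theta^{EB}\|^2=V\,[\,m-(m-p-2)B\,]$. -/

import Mathlib

open MeasureTheory ProbabilityTheory
open scoped NNReal Matrix

namespace AreaLevel

/-- A product of independent normal laws `N(θ i, V)` depends measurably on the vector of means. -/
lemma measurable_pi_gaussianReal (m : ℕ) (V : ℝ≥0) :
    Measurable fun θ : Fin m → ℝ => Measure.pi fun i => gaussianReal (θ i) V := by
  refine Measurable.measure_of_isPiSystem_of_isProbabilityMeasure generateFrom_pi.symm
    isPiSystem_pi ?_
  rintro _ ⟨s, hs, rfl⟩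
  simp only [Measure.pi_pi]
  refine Finset.measurable_prod _ fun i _ => ?_
  have h : Measurable fun θ : Fin m → ℝ => gaussianReal (θ i) V :=
    measurable_gaussianReal.comp
      (g := Function.uncurry gaussianReal) (f := fun θ : Fin m → ℝ => (θ i, V))
      ((measurable_pi_apply i).prodMk measurable_const)
  have hsi : MeasurableSet (s i) := hs i (Set.mem_univ i)
  exact (Measure.measurable_coe hsi).comp h

/-- The sampling kernel: given `θ`, the coordinates `y i` are independent with
`y i ∼ N(θ i, V)`. -/
noncomputable def samplingKernel (m : ℕ) (V : ℝ≥0) : Kernel (Fin m → ℝ) (Fin m → ℝ) where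
  toFun θ := Measure.pi fun i => gaussianReal (θ i) V
  measurable' := measurable_pi_gaussianReal m V

/-- The law of `θ`: the coordinates `θ i` are independent with `θ i ∼ N(xᵢᵀβ, A)`, where `xᵢ`
is the `i`-th row of `X`. -/
noncomputable def linkingLaw {m p : ℕ} (X : Matrix (Fin m) (Fin p) ℝ) (β : Fin p → ℝ) (A : ℝ≥0) :
    Measure (Fin m → ℝ) :=
  Measure.pi fun i => gaussianReal (X i ⬝ᵥ β) A

/-- The two-stage normal model: `θ i ∼ N(xᵢᵀβ, A)` independently, and, conditionally on `θ`,
`y i ∼ N(θ i, V)` independently. -/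
structure IsAreaLevelModel {Ω : Type*} [MeasurableSpace Ω] (P : Measure Ω) {m p : ℕ}
    (X : Matrix (Fin m) (Fin p) ℝ) (β : Fin p → ℝ) (V A : ℝ≥0) (θ y : Ω → Fin m → ℝ) : Prop where
  law_theta : HasLaw θ (linkingLaw X β A) P
  law_y_given_theta : HasCondDistrib y θ (samplingKernel m V) P

/-- The shrinkage factor `B = V / (V + A)`. -/
noncomputable def shrinkage (V A : ℝ≥0) : ℝ := (V : ℝ) / (V + A)

/-- The least squares estimator `(XᵀX)⁻¹ Xᵀ y`. -/
noncomputable def betaHat {m p : ℕ} (X : Matrix (Fin m) (Fin p) ℝ) (y : Fin m → ℝ) : Fin p → ℝ :=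
  (Xᵀ * X)⁻¹ *ᵥ (Xᵀ *ᵥ y)

/-- The residual sum of squares `S = ‖y - X β̂‖²` (Euclidean norm). -/
noncomputable def residualSS {m p : ℕ} (X : Matrix (Fin m) (Fin p) ℝ) (y : Fin m → ℝ) : ℝ :=
  ‖WithLp.toLp 2 (y - X *ᵥ betaHat X y)‖ ^ 2

/-- The estimator `V (m - p - 2) / S` of `B`. -/
noncomputable def shrinkageHatEB {m p : ℕ} (X : Matrix (Fin m) (Fin p) ℝ) (V : ℝ≥0)
    (y : Fin m → ℝ) : ℝ :=
  (V : ℝ) * ((m : ℝ) - p - 2) / residualSS X y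

/-- The empirical Bayes (James–Stein) estimator `(1 - B̂) y + B̂ X β̂` of `θ`. -/
noncomputable def thetaHatEB {m p : ℕ} (X : Matrix (Fin m) (Fin p) ℝ) (V : ℝ≥0)
    (y : Fin m → ℝ) : Fin m → ℝ :=
  (1 - shrinkageHatEB X V y) • y + shrinkageHatEB X V y • (X *ᵥ betaHat X y)

/-- The leverage `hᵢᵢ = xᵢᵀ (XᵀX)⁻¹ xᵢ`. -/
noncomputable def leverage {m p : ℕ} (X : Matrix (Fin m) (Fin p) ℝ) (i : Fin m) : ℝ :=
  X i ⬝ᵥ ((Xᵀ * X)⁻¹ *ᵥ X i)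

end AreaLevel

/-!
A rotation of the two independent noise vectors turns the model into `y = X β + σ Z` and
`θ = E[θ | y] + noise`, with `σ² = V + A`, `Z` a standard normal vector, the noise independent of
`Z` and `E[θ | y] = (1 - B) y + B X β`. Hence `θ - θ̂` is this noise minus `σ B` times the
James–Stein estimate of the mean of `Z`, shrunk towards the column space `K` of `X`. The `K`-part of
that estimate is the projection of `Z`, uncorrelated with the rest. The `Kᗮ`-part is the ordinary
James–Stein estimate in dimension `d = m - p`; its expected squared norm is
`d - 2 (d - 2) + (d - 2)² E[1 / ‖Z‖²] = 2`, and rotation invariance spreads it evenly over the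
directions of `Kᗮ`. The inverse moment `E[1 / ‖Z‖²] = 1 / (d - 2)` in dimension `d` comes from
`1 / s = ∫ t in (1, ∞), exp ((1 - t) s)` and the Gaussian integral of `exp ((1 - t) ‖Z‖² / 2)`.
-/

namespace AreaLevel

open Module
open scoped RealInnerProductSpace

section SecondMoment

lemma integral_add_sq_of_integral_mul_eq_zero {Ω : Type*} [MeasurableSpace Ω] {μ : Measure Ω}
    {f g : Ω → ℝ} (hf : MemLp f 2 μ) (hg : MemLp g 2 μ) (hfg : ∫ x, f x * g x ∂μ = 0) :
    ∫ x, (f x + g x) ^ 2 ∂μ = ∫ x, f x ^ 2 ∂μ + ∫ x, g x ^ 2 ∂μ := by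
  have hsq : Integrable (fun x ↦ f x ^ 2 + g x ^ 2) μ := hf.integrable_sq.add hg.integrable_sq
  have hmul : Integrable (fun x ↦ 2 * (f x * g x)) μ := (hf.integrable_mul hg).const_mul 2
  calc ∫ x, (f x + g x) ^ 2 ∂μ
      = ∫ x, (f x ^ 2 + g x ^ 2) + 2 * (f x * g x) ∂μ := by
        congr with x
        ring
    _ = ∫ x, f x ^ 2 ∂μ + ∫ x, g x ^ 2 ∂μ := by
        rw [integral_add hsq hmul, integral_add hf.integrable_sq hg.integrable_sq,
          integral_const_mul, hfg, mul_zero, add_zero]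

lemma integral_prod_add_sq {F G : Type*} [MeasurableSpace F] [MeasurableSpace G] {μ : Measure F}
    {ν : Measure G} [IsProbabilityMeasure μ] [IsProbabilityMeasure ν] {f : F → ℝ} {g : G → ℝ}
    (hf : MemLp f 2 μ) (hg : MemLp g 2 ν) (hg0 : ∫ y, g y ∂ν = 0) :
    ∫ z, (f z.1 + g z.2) ^ 2 ∂μ.prod ν = ∫ x, f x ^ 2 ∂μ + ∫ y, g y ^ 2 ∂ν := by
  rw [integral_add_sq_of_integral_mul_eq_zero (hf.comp_fst ν) (hg.comp_snd μ)
    (by rw [integral_prod_mul, hg0, mul_zero])]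
  congr 1
  · simpa using integral_prod_mul (μ := μ) (ν := ν) (fun x ↦ f x ^ 2) fun _ ↦ 1
  · simpa using integral_prod_mul (μ := μ) (ν := ν) (fun _ ↦ 1) fun y ↦ g y ^ 2

end SecondMoment

section Shrinkage

variable (V A : ℝ≥0)

lemma add_mul_shrinkage : ((V : ℝ) + A) * shrinkage V A = V := by
  refine mul_div_cancel_of_imp' fun h ↦ ?_
  linarith [V.coe_nonneg, A.coe_nonneg]

lemma add_mul_one_sub_shrinkage : ((V : ℝ) + A) * (1 - shrinkage V A) = A := by
  rw [mul_one_sub, add_mul_shrinkage, add_sub_cancel_left]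

lemma shrinkage_nonneg : 0 ≤ shrinkage V A := by
  unfold shrinkage
  positivity

lemma shrinkage_le_one : shrinkage V A ≤ 1 :=
  div_le_one_of_le₀ (le_add_of_nonneg_right A.coe_nonneg) (by positivity)

end Shrinkage

section StdGaussian

lemma integral_exp_one_sub_mul_sq_gaussianReal {t : ℝ} (ht : 0 < t) :
    ∫ x, Real.exp ((1 - t) * x ^ 2 / 2) ∂gaussianReal 0 1 = t ^ (-(1 / 2) : ℝ) := by
  have hpdf (x : ℝ) : gaussianPDFReal 0 1 x • Real.exp ((1 - t) * x ^ 2 / 2)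
      = (√(2 * Real.pi))⁻¹ * Real.exp (-(t / 2) * x ^ 2) := by
    rw [gaussianPDFReal, smul_eq_mul, mul_assoc, ← Real.exp_add]
    congr 2
    · simp
    · push_cast
      ring
  simp_rw [integral_gaussianReal_eq_integral_smul one_ne_zero, hpdf]
  rw [integral_const_mul, integral_gaussian, ← Real.sqrt_inv, ← Real.sqrt_mul (by positivity),
    Real.rpow_neg ht.le, ← Real.sqrt_eq_rpow, ← Real.sqrt_inv]
  congr 1
  field_simp

lemma lintegral_Ioi_exp_one_sub_mul {s : ℝ} (hs : 0 < s) :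
    ∫⁻ t in Set.Ioi (1 : ℝ), ENNReal.ofReal (Real.exp ((1 - t) * s)) = ENNReal.ofReal s⁻¹ := by
  have hexp (t : ℝ) : Real.exp ((1 - t) * s) = Real.exp s * Real.exp (-s * t) := by
    rw [← Real.exp_add]
    ring_nf
  have hint := (integrableOn_exp_mul_Ioi (neg_lt_zero.mpr hs) 1).const_mul (Real.exp s)
  simp_rw [hexp]
  rw [← ofReal_integral_eq_lintegral_ofReal hint (.of_forall fun t ↦ by positivity),
    integral_const_mul, integral_exp_mul_Ioi (neg_lt_zero.mpr hs), mul_one, neg_div_neg_eq,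
    mul_div_assoc', ← Real.exp_add, add_neg_cancel, Real.exp_zero, one_div]

lemma lintegral_Ioi_one_rpow_neg {r : ℝ} (hr : 1 < r) :
    ∫⁻ t in Set.Ioi (1 : ℝ), ENNReal.ofReal (t ^ (-r)) = ENNReal.ofReal (r - 1)⁻¹ := by
  have hr' : -r < -1 := neg_lt_neg hr
  rw [← ofReal_integral_eq_lintegral_ofReal (integrableOn_Ioi_rpow_of_lt hr' one_pos)
    (ae_restrict_of_forall_mem measurableSet_Ioi fun t (ht : 1 < t) ↦ by positivity),
    integral_Ioi_rpow_of_lt hr' one_pos, Real.one_rpow]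
  congr 1
  rw [← neg_sub, neg_div, ← div_neg, one_div]
  congr 1
  ring

variable {E : Type*} [NormedAddCommGroup E] [InnerProductSpace ℝ E] [FiniteDimensional ℝ E]
  [MeasurableSpace E] [BorelSpace E]

lemma integral_exp_one_sub_mul_norm_sq_stdGaussian {t : ℝ} (ht : 0 < t) :
    ∫ x, Real.exp ((1 - t) * ‖x‖ ^ 2 / 2) ∂stdGaussian E = t ^ (-(finrank ℝ E / 2) : ℝ) := by
  have hnorm (x : Fin (finrank ℝ E) → ℝ) :
      Real.exp ((1 - t) * ‖∑ i, x i • stdOrthonormalBasis ℝ E i‖ ^ 2 / 2)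
        = ∏ i, Real.exp ((1 - t) * x i ^ 2 / 2) := by
    rw [← real_inner_self_eq_norm_sq, (stdOrthonormalBasis ℝ E).orthonormal.inner_sum,
      ← Real.exp_sum, Finset.mul_sum, Finset.sum_div]
    simp [pow_two]
  rw [stdGaussian, integral_map (Measurable.aemeasurable (by fun_prop)) (by fun_prop)]
  simp_rw [hnorm]
  rw [integral_fintype_prod_eq_pow (fun y : ℝ ↦ Real.exp ((1 - t) * y ^ 2 / 2)),
    integral_exp_one_sub_mul_sq_gaussianReal ht, ← Real.rpow_natCast,
    ← Real.rpow_mul ht.le, Fintype.card_fin]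
  congr 1
  ring

lemma lintegral_exp_one_sub_mul_norm_sq_stdGaussian {t : ℝ} (ht : 0 < t) :
    ∫⁻ x, ENNReal.ofReal (Real.exp ((1 - t) * (‖x‖ ^ 2 / 2))) ∂stdGaussian E
      = ENNReal.ofReal (t ^ (-(finrank ℝ E / 2) : ℝ)) := by
  have h := integral_exp_one_sub_mul_norm_sq_stdGaussian (E := E) ht
  simp_rw [mul_div_assoc] at h
  have hint := Integrable.of_integral_ne_zero (h.trans_ne (Real.rpow_pos_of_pos ht _).ne')
  rw [← h, ofReal_integral_eq_lintegral_ofReal hint (.of_forall fun x ↦ by positivity)]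

lemma ae_ne_zero_stdGaussian [Nontrivial E] : ∀ᵐ x ∂stdGaussian E, x ≠ 0 := by
  obtain ⟨v, hv⟩ := exists_ne (0 : E)
  have hmap : (stdGaussian E).map (innerSL ℝ v) = gaussianReal 0 (‖v‖ ^ 2).toNNReal := by
    rw [IsGaussian.map_eq_gaussianReal, integral_strongDual_stdGaussian,
      variance_dual_stdGaussian, innerSL_apply_norm]
  have hnull := nullSingletonClass_gaussianReal (μ := 0) (v := (‖v‖ ^ 2).toNNReal)
    (by simpa using hv)
  have hne : ∀ᵐ t ∂(stdGaussian E).map (innerSL ℝ v), t ≠ 0 := by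
    rw [hmap]
    simp [ae_iff]
  filter_upwards [ae_of_ae_map (by fun_prop) hne] with x hx
  rintro rfl
  simp at hx

lemma lintegral_inv_norm_sq_stdGaussian (hE : 2 < finrank ℝ E) :
    ∫⁻ x, ENNReal.ofReal (‖x‖ ^ 2 / 2)⁻¹ ∂stdGaussian E
      = ENNReal.ofReal (finrank ℝ E / 2 - 1 : ℝ)⁻¹ := by
  have hd : (1 : ℝ) < finrank ℝ E / 2 := by
    rw [one_lt_div two_pos]
    exact_mod_cast hE
  have : Nontrivial E := nontrivial_of_finrank_pos (R := ℝ) (by omega)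
  calc ∫⁻ x, ENNReal.ofReal (‖x‖ ^ 2 / 2)⁻¹ ∂stdGaussian E
      = ∫⁻ x, (∫⁻ t in Set.Ioi (1 : ℝ), ENNReal.ofReal (Real.exp ((1 - t) * (‖x‖ ^ 2 / 2))))
          ∂stdGaussian E := by
        refine lintegral_congr_ae ?_
        filter_upwards [ae_ne_zero_stdGaussian (E := E)] with x hx
        rw [lintegral_Ioi_exp_one_sub_mul (by positivity)]
    _ = ∫⁻ t in Set.Ioi (1 : ℝ), ∫⁻ x, ENNReal.ofReal (Real.exp ((1 - t) * (‖x‖ ^ 2 / 2)))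
          ∂stdGaussian E :=
        lintegral_lintegral_swap (Measurable.aemeasurable (by fun_prop))
    _ = ∫⁻ t in Set.Ioi (1 : ℝ), ENNReal.ofReal (t ^ (-(finrank ℝ E / 2) : ℝ)) :=
        setLIntegral_congr_fun measurableSet_Ioi fun t ht ↦
          lintegral_exp_one_sub_mul_norm_sq_stdGaussian (one_pos.trans ht)
    _ = ENNReal.ofReal (finrank ℝ E / 2 - 1 : ℝ)⁻¹ := lintegral_Ioi_one_rpow_neg hd

lemma integrable_inv_norm_sq_stdGaussian (hE : 2 < finrank ℝ E) :
    Integrable (fun x : E ↦ (‖x‖ ^ 2)⁻¹) (stdGaussian E) := by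
  have h : Integrable (fun x : E ↦ (‖x‖ ^ 2 / 2)⁻¹) (stdGaussian E) := by
    rw [← lintegral_ofReal_ne_top_iff_integrable (by fun_prop)
      (.of_forall fun x ↦ by positivity), lintegral_inv_norm_sq_stdGaussian hE]
    exact ENNReal.ofReal_ne_top
  refine (h.div_const 2).congr (.of_forall fun x ↦ ?_)
  simp only [inv_div, div_div_cancel_left' (two_ne_zero' ℝ)]

lemma integral_inv_norm_sq_stdGaussian (hE : 2 < finrank ℝ E) :
    ∫ x, (‖x‖ ^ 2)⁻¹ ∂stdGaussian E = (finrank ℝ E - 2 : ℝ)⁻¹ := by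
  have hd : (2 : ℝ) < finrank ℝ E := by exact_mod_cast hE
  have h : ∫ x, (‖x‖ ^ 2 / 2)⁻¹ ∂stdGaussian E = (finrank ℝ E / 2 - 1 : ℝ)⁻¹ := by
    rw [integral_eq_lintegral_of_nonneg_ae (.of_forall fun x ↦ by positivity) (by fun_prop),
      lintegral_inv_norm_sq_stdGaussian hE,
      ENNReal.toReal_ofReal (inv_nonneg.mpr (by linarith))]
  simp_rw [inv_div, div_eq_mul_inv, integral_const_mul] at h
  rw [← mul_right_inj' two_ne_zero, h, ← div_eq_mul_inv, div_sub_one two_ne_zero, inv_div,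
    div_eq_mul_inv]

lemma memLp_inner_stdGaussian (u : E) : MemLp (fun x ↦ ⟪u, x⟫) 2 (stdGaussian E) :=
  IsGaussian.memLp_dual _ (innerSL ℝ u) 2 (by simp)

variable (E) in
lemma integrable_norm_sq_stdGaussian : Integrable (fun x ↦ ‖x‖ ^ 2) (stdGaussian E) :=
  IsGaussian.memLp_two_id.integrable_norm_pow two_ne_zero

lemma integral_inner_sq_stdGaussian (u : E) : ∫ x, ⟪u, x⟫ ^ 2 ∂stdGaussian E = ‖u‖ ^ 2 := by
  have hvar := variance_dual_stdGaussian (innerSL ℝ u)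
  rwa [variance_of_integral_eq_zero (by fun_prop) (integral_strongDual_stdGaussian _),
    innerSL_apply_norm] at hvar

lemma integral_norm_sq_stdGaussian : ∫ x, ‖x‖ ^ 2 ∂stdGaussian E = finrank ℝ E := by
  simp_rw [← (stdOrthonormalBasis ℝ E).sum_sq_inner_right]
  rw [integral_finsetSum _ fun i _ ↦ (memLp_inner_stdGaussian _).integrable_sq]
  simp_rw [integral_inner_sq_stdGaussian]
  simp

variable {g : ℝ → ℝ}

lemma integrable_inner_sq_mul_of_norm_sq_mul {μ : Measure E} (u : E) (hg : Measurable g)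
    (h : Integrable (fun x ↦ ‖x‖ ^ 2 * g ‖x‖) μ) :
    Integrable (fun x ↦ ⟪u, x⟫ ^ 2 * g ‖x‖) μ := by
  refine (h.const_mul (‖u‖ ^ 2)).mono (by fun_prop) (.of_forall fun x ↦ ?_)
  have hcs : ⟪u, x⟫ ^ 2 ≤ ‖u‖ ^ 2 * ‖x‖ ^ 2 := by
    rw [← mul_pow, sq_le_sq, abs_of_nonneg (by positivity : 0 ≤ ‖u‖ * ‖x‖)]
    exact abs_real_inner_le_norm u x
  simp only [norm_mul, norm_pow, Real.norm_eq_abs, sq_abs, abs_norm, ← mul_assoc]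
  gcongr

lemma measurePreserving_stdGaussian (R : E ≃ₗᵢ[ℝ] E) :
    MeasurePreserving R (stdGaussian E) (stdGaussian E) :=
  ⟨by fun_prop, stdGaussian_map R⟩

lemma integral_inner_sq_mul_eq_of_norm_eq {u v : E} (huv : ‖u‖ = ‖v‖) :
    ∫ x, ⟪u, x⟫ ^ 2 * g ‖x‖ ∂stdGaussian E = ∫ x, ⟪v, x⟫ ^ 2 * g ‖x‖ ∂stdGaussian E := by
  obtain ⟨R, rfl⟩ : ∃ R : E ≃ₗᵢ[ℝ] E, R u = v := ⟨_, Submodule.reflection_sub huv⟩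
  rw [← (measurePreserving_stdGaussian R).integral_comp R.toHomeomorph.measurableEmbedding
    fun x ↦ ⟪R u, x⟫ ^ 2 * g ‖x‖]
  simp_rw [R.inner_map_map, R.norm_map]

lemma finrank_mul_integral_inner_sq_mul_stdGaussian (u : E) (hg : Measurable g)
    (h : Integrable (fun x ↦ ‖x‖ ^ 2 * g ‖x‖) (stdGaussian E)) :
    finrank ℝ E * ∫ x, ⟪u, x⟫ ^ 2 * g ‖x‖ ∂stdGaussian E
      = ‖u‖ ^ 2 * ∫ x, ‖x‖ ^ 2 * g ‖x‖ ∂stdGaussian E := by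
  set b := stdOrthonormalBasis ℝ E
  have hb (i) : ∫ x, ⟪u, x⟫ ^ 2 * g ‖x‖ ∂stdGaussian E
      = ‖u‖ ^ 2 * ∫ x, ⟪b i, x⟫ ^ 2 * g ‖x‖ ∂stdGaussian E := by
    rw [integral_inner_sq_mul_eq_of_norm_eq (v := ‖u‖ • b i) (by simp [norm_smul])]
    simp_rw [real_inner_smul_left, mul_pow, mul_assoc, integral_const_mul]
  calc finrank ℝ E * ∫ x, ⟪u, x⟫ ^ 2 * g ‖x‖ ∂stdGaussian E
      = ∑ i, ‖u‖ ^ 2 * ∫ x, ⟪b i, x⟫ ^ 2 * g ‖x‖ ∂stdGaussian E := by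
        simp_rw [← hb, Finset.sum_const, Finset.card_univ, Fintype.card_fin, nsmul_eq_mul]
    _ = ‖u‖ ^ 2 * ∫ x, ∑ i, ⟪b i, x⟫ ^ 2 * g ‖x‖ ∂stdGaussian E := by
        rw [← Finset.mul_sum,
          integral_finsetSum _ fun i _ ↦ integrable_inner_sq_mul_of_norm_sq_mul (b i) hg h]
    _ = ‖u‖ ^ 2 * ∫ x, ‖x‖ ^ 2 * g ‖x‖ ∂stdGaussian E := by
        simp_rw [← Finset.sum_mul, b.sum_sq_inner_right]

lemma measurePreserving_orthogonalProjectionOnto_stdGaussian (K : Submodule ℝ E) :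
    MeasurePreserving K.orthogonalProjectionOnto (stdGaussian E) (stdGaussian K) := by
  refine ⟨by fun_prop, Measure.ext_of_charFun (funext fun k ↦ ?_)⟩
  have h : charFun ((stdGaussian E).map K.orthogonalProjectionOnto) k
      = charFun (stdGaussian E) k := by
    simp_rw [charFun_apply]
    rw [integral_map (by fun_prop) (by fun_prop)]
    simp only [Submodule.inner_orthogonalProjectionOnto_eq_of_mem_right]
  rw [h, charFun_stdGaussian, charFun_stdGaussian, Submodule.coe_norm]

end StdGaussian

section JamesStein

variable {E : Type*} [NormedAddCommGroup E] [InnerProductSpace ℝ E]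

/-- The James–Stein estimator of the mean of a spherical normal vector `x` with variance `v` in each
direction, shrinking towards `0`. Its value at `x = 0` is `0`. -/
noncomputable def jamesStein (v : ℝ) (x : E) : E :=
  (1 - v * (finrank ℝ E - 2) / ‖x‖ ^ 2) • x

lemma inner_jamesStein_sq (v : ℝ) (u x : E) :
    ⟪u, jamesStein v x⟫ ^ 2 = ⟪u, x⟫ ^ 2 * (1 - v * (finrank ℝ E - 2) / ‖x‖ ^ 2) ^ 2 := by
  rw [jamesStein, real_inner_smul_right, mul_pow, mul_comm]

lemma norm_jamesStein_sq (v : ℝ) (x : E) :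
    ‖jamesStein v x‖ ^ 2 = ‖x‖ ^ 2 * (1 - v * (finrank ℝ E - 2) / ‖x‖ ^ 2) ^ 2 := by
  rw [jamesStein, norm_smul, mul_pow, Real.norm_eq_abs, sq_abs, mul_comm]

lemma norm_jamesStein_sq_of_ne_zero (v : ℝ) {x : E} (hx : x ≠ 0) :
    ‖jamesStein v x‖ ^ 2
      = ‖x‖ ^ 2 - 2 * (v * (finrank ℝ E - 2)) + (v * (finrank ℝ E - 2)) ^ 2 * (‖x‖ ^ 2)⁻¹ := by
  have : ‖x‖ ≠ 0 := norm_ne_zero_iff.mpr hx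
  rw [norm_jamesStein_sq]
  field_simp
  ring

lemma jamesStein_smul (s v : ℝ) (x : E) :
    jamesStein (s ^ 2 * v) (s • x) = s • jamesStein v x := by
  obtain rfl | hs := eq_or_ne s 0
  · simp [jamesStein]
  · rw [jamesStein, jamesStein, smul_comm, norm_smul, mul_pow, Real.norm_eq_abs, sq_abs, mul_assoc,
      mul_div_mul_left _ _ (pow_ne_zero 2 hs)]

lemma jamesStein_eq_add_smul (b : ℝ) (x : E) :
    jamesStein b x = (1 - b) • x + b • jamesStein 1 x := by
  rw [jamesStein, jamesStein, smul_smul, ← add_smul]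
  congr 1
  ring

/-- The James–Stein estimator that shrinks the observation `x` towards its orthogonal projection
onto the subspace `K`. -/
noncomputable def jamesSteinToward (K : Submodule ℝ E) [K.HasOrthogonalProjection] (v : ℝ) (x : E) :
    E :=
  K.starProjection x + jamesStein v (Kᗮ.orthogonalProjectionOnto x)

section Toward

variable (K : Submodule ℝ E) [K.HasOrthogonalProjection]

lemma jamesSteinToward_add_smul {μ : E} (hμ : μ ∈ K) (s v : ℝ) (x : E) :
    jamesSteinToward K (s ^ 2 * v) (μ + s • x) = μ + s • jamesSteinToward K v x := by
  have hμ' : Kᗮ.orthogonalProjectionOnto μ = 0 :=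
    Submodule.orthogonalProjectionOnto_orthogonal_apply_eq_zero hμ
  simp only [jamesSteinToward, map_add, map_smul, hμ', zero_add, jamesStein_smul,
    Submodule.starProjection_eq_self_iff.mpr hμ, Submodule.coe_smul, smul_add, add_assoc]

lemma jamesSteinToward_eq_add_smul (b : ℝ) (x : E) :
    jamesSteinToward K b x = (1 - b) • x + b • jamesSteinToward K 1 x := by
  have hx : K.starProjection x + Kᗮ.starProjection x = x :=
    Submodule.starProjection_add_starProjection_orthogonal _
  rw [jamesSteinToward, jamesStein_eq_add_smul, jamesSteinToward]
  nth_rw 4 [← hx]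
  simp only [Submodule.coe_add, Submodule.coe_smul, Submodule.starProjection_apply]
  module

lemma inner_jamesSteinToward (v : ℝ) (u x : E) :
    ⟪u, jamesSteinToward K v x⟫ = ⟪K.starProjection u, x⟫
      + ⟪Kᗮ.orthogonalProjectionOnto u, jamesStein v (Kᗮ.orthogonalProjectionOnto x)⟫ := by
  rw [jamesSteinToward, inner_add_right, Submodule.inner_starProjection_left_eq_right,
    Submodule.inner_orthogonalProjectionOnto_eq_of_mem_right]

lemma posterior_sub_jamesSteinToward {μ : E} (hμ : μ ∈ K) (V A : ℝ≥0) (x w : E) :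
    (μ + √((V : ℝ) + A) • ((1 - shrinkage V A) • x
        - √(shrinkage V A * (1 - shrinkage V A)) • w))
        - jamesSteinToward K V (μ + √((V : ℝ) + A) • x)
      = -(√((V : ℝ) + A) * shrinkage V A) • jamesSteinToward K 1 x
        + -(√((V : ℝ) + A) * √(shrinkage V A * (1 - shrinkage V A))) • w := by
  have hV : (V : ℝ) = √((V : ℝ) + A) ^ 2 * shrinkage V A := by
    rw [Real.sq_sqrt (by positivity), add_mul_shrinkage]
  nth_rw 2 [hV]
  rw [jamesSteinToward_add_smul K hμ, jamesSteinToward_eq_add_smul K (shrinkage V A)]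
  module

end Toward

variable [FiniteDimensional ℝ E] [MeasurableSpace E] [BorelSpace E]

@[fun_prop]
lemma measurable_jamesStein (v : ℝ) : Measurable (jamesStein v : E → E) := by
  unfold jamesStein
  fun_prop

lemma ae_norm_jamesStein_sq_stdGaussian [Nontrivial E] (v : ℝ) :
    ∀ᵐ x : E ∂stdGaussian E, ‖jamesStein v x‖ ^ 2
      = ‖x‖ ^ 2 - 2 * (v * (finrank ℝ E - 2)) + (v * (finrank ℝ E - 2)) ^ 2 * (‖x‖ ^ 2)⁻¹ :=
  ae_ne_zero_stdGaussian.mono fun _ ↦ norm_jamesStein_sq_of_ne_zero v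

lemma integrable_norm_jamesStein_sq_stdGaussian (hE : 2 < finrank ℝ E) (v : ℝ) :
    Integrable (fun x : E ↦ ‖jamesStein v x‖ ^ 2) (stdGaussian E) := by
  have : Nontrivial E := nontrivial_of_finrank_pos (R := ℝ) (by omega)
  rw [integrable_congr (ae_norm_jamesStein_sq_stdGaussian v)]
  exact ((integrable_norm_sq_stdGaussian E).sub (integrable_const _)).add
    ((integrable_inv_norm_sq_stdGaussian hE).const_mul _)

lemma integral_norm_jamesStein_sq_stdGaussian (hE : 2 < finrank ℝ E) (v : ℝ) :
    ∫ x : E, ‖jamesStein v x‖ ^ 2 ∂stdGaussian E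
      = finrank ℝ E - v * (2 - v) * (finrank ℝ E - 2) := by
  have : Nontrivial E := nontrivial_of_finrank_pos (R := ℝ) (by omega)
  have : (finrank ℝ E - 2 : ℝ) ≠ 0 := sub_ne_zero.mpr (by exact_mod_cast hE.ne')
  have hsub : Integrable (fun x : E ↦ ‖x‖ ^ 2 - 2 * (v * (finrank ℝ E - 2))) (stdGaussian E) :=
    (integrable_norm_sq_stdGaussian E).sub (integrable_const _)
  rw [integral_congr_ae (ae_norm_jamesStein_sq_stdGaussian v),
    integral_add hsub ((integrable_inv_norm_sq_stdGaussian hE).const_mul _),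
    integral_sub (integrable_norm_sq_stdGaussian E) (integrable_const _), integral_const,
    probReal_univ, one_smul, integral_const_mul, integral_norm_sq_stdGaussian,
    integral_inv_norm_sq_stdGaussian hE]
  field_simp
  ring

lemma memLp_inner_jamesStein_stdGaussian (hE : 2 < finrank ℝ E) (u : E) (v : ℝ) :
    MemLp (fun x ↦ ⟪u, jamesStein v x⟫) 2 (stdGaussian E) := by
  have h := integrable_norm_jamesStein_sq_stdGaussian hE v
  exact ((memLp_two_iff_integrable_sq_norm (by fun_prop)).mpr h).const_inner u

lemma integral_inner_jamesStein_one_sq_stdGaussian (hE : 2 < finrank ℝ E) (u : E) :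
    ∫ x, ⟪u, jamesStein 1 x⟫ ^ 2 ∂stdGaussian E = 2 * ‖u‖ ^ 2 / finrank ℝ E := by
  have h := integrable_norm_jamesStein_sq_stdGaussian hE 1
  have hnorm : ∫ x : E, ‖jamesStein 1 x‖ ^ 2 ∂stdGaussian E = 2 := by
    rw [integral_norm_jamesStein_sq_stdGaussian hE]
    ring
  have hd : (finrank ℝ E : ℝ) ≠ 0 := by positivity
  rw [eq_div_iff hd, mul_comm, ← hnorm, mul_comm _ (‖u‖ ^ 2)]
  simp_rw [norm_jamesStein_sq, inner_jamesStein_sq] at h ⊢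
  exact finrank_mul_integral_inner_sq_mul_stdGaussian
    (g := fun r ↦ (1 - 1 * (finrank ℝ E - 2) / r ^ 2) ^ 2) u (by fun_prop) h

section Toward

variable (K : Submodule ℝ E) (u : E)

@[fun_prop]
lemma measurable_jamesSteinToward (v : ℝ) : Measurable (jamesSteinToward K v) := by
  unfold jamesSteinToward
  fun_prop

lemma memLp_inner_jamesSteinToward_stdGaussian (hK : 2 < finrank ℝ Kᗮ) (v : ℝ) :
    MemLp (fun x ↦ ⟪u, jamesSteinToward K v x⟫) 2 (stdGaussian E) := by
  simp_rw [inner_jamesSteinToward]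
  exact (memLp_inner_stdGaussian _).add <|
    (memLp_inner_jamesStein_stdGaussian hK _ v).comp_measurePreserving
      (measurePreserving_orthogonalProjectionOnto_stdGaussian Kᗮ)

-- Reflecting in `Kᗮ` preserves the law of `x` and changes the sign of the integrand.
lemma integral_inner_starProjection_mul_stdGaussian (f : Kᗮ → ℝ) :
    ∫ x, ⟪K.starProjection u, x⟫ * f (Kᗮ.orthogonalProjectionOnto x) ∂stdGaussian E = 0 := by
  have hinner (x : E) : ⟪K.starProjection u, Kᗮ.reflection x⟫ = -⟪K.starProjection u, x⟫ := by
    rw [Submodule.reflection_apply, inner_sub_right, two_smul, inner_add_right,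
      Submodule.inner_right_of_mem_orthogonal (K.starProjection_apply_mem u)
        (Kᗮ.starProjection_apply_mem x)]
    ring
  have hproj (x : E) :
      Kᗮ.orthogonalProjectionOnto (Kᗮ.reflection x) = Kᗮ.orthogonalProjectionOnto x := by
    rw [Submodule.reflection_apply, map_sub, map_nsmul, two_smul, Submodule.starProjection_apply,
      Submodule.orthogonalProjectionOnto_mem_subspace_eq_self, add_sub_cancel_right]
  have h := (measurePreserving_stdGaussian Kᗮ.reflection).integral_comp
    Kᗮ.reflection.toHomeomorph.measurableEmbedding
    fun x ↦ ⟪K.starProjection u, x⟫ * f (Kᗮ.orthogonalProjectionOnto x)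
  simp_rw [hinner, hproj, neg_mul, integral_neg] at h
  exact neg_eq_self.mp h

lemma integral_inner_jamesSteinToward_one_sq_stdGaussian (hK : 2 < finrank ℝ Kᗮ) :
    ∫ x, ⟪u, jamesSteinToward K 1 x⟫ ^ 2 ∂stdGaussian E
      = ‖K.starProjection u‖ ^ 2 + 2 * ‖Kᗮ.starProjection u‖ ^ 2 / finrank ℝ Kᗮ := by
  have hproj := measurePreserving_orthogonalProjectionOnto_stdGaussian Kᗮ
  have hJS : MemLp (fun x ↦ ⟪Kᗮ.orthogonalProjectionOnto u,
      jamesStein 1 (Kᗮ.orthogonalProjectionOnto x)⟫) 2 (stdGaussian E) :=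
    (memLp_inner_jamesStein_stdGaussian hK _ 1).comp_measurePreserving hproj
  simp_rw [inner_jamesSteinToward]
  rw [integral_add_sq_of_integral_mul_eq_zero (memLp_inner_stdGaussian _) hJS
    (integral_inner_starProjection_mul_stdGaussian K u
      fun x ↦ ⟪Kᗮ.orthogonalProjectionOnto u, jamesStein 1 x⟫), integral_inner_sq_stdGaussian]
  congr 1
  rw [Submodule.starProjection_apply, ← Submodule.coe_norm,
    ← integral_inner_jamesStein_one_sq_stdGaussian hK, ← hproj.map_eq,
    integral_map hproj.aemeasurable (by fun_prop)]

end Toward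

end JamesStein

section TwoStageGaussian

variable {E : Type*} [NormedAddCommGroup E] [InnerProductSpace ℝ E] [FiniteDimensional ℝ E]
  [MeasurableSpace E] [BorelSpace E]

/-- The joint law of a spherical normal vector `θ` with mean `μ` and variance `A` in each direction
and of an observation `y` of `θ` with independent spherical normal noise of variance `V`. -/
noncomputable def twoStageGaussian (μ : E) (V A : ℝ≥0) : Measure (E × E) :=
  ((stdGaussian E).prod (stdGaussian E)).map
    fun z ↦ (μ + √(A : ℝ) • z.1, μ + √(A : ℝ) • z.1 + √(V : ℝ) • z.2)

-- The joint law of two independent standard normal vectors is invariant under rotations of the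
-- pair; the angle below, with `sin² φ = B`, turns `y - μ` into a multiple of the first vector.
lemma twoStageGaussian_eq_map_posterior (μ : E) (V A : ℝ≥0) :
    twoStageGaussian μ V A = ((stdGaussian E).prod (stdGaussian E)).map fun z ↦
      (μ + √((V : ℝ) + A) • ((1 - shrinkage V A) • z.1
        - √(shrinkage V A * (1 - shrinkage V A)) • z.2), μ + √((V : ℝ) + A) • z.1) := by
  set B := shrinkage V A
  set φ := -Real.arcsin √B
  have hB : 0 ≤ B := shrinkage_nonneg V A
  have hB' : 0 ≤ 1 - B := sub_nonneg.mpr (shrinkage_le_one V A)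
  have hsin : Real.sin φ = -√B := by
    rw [Real.sin_neg, Real.sin_arcsin (by linarith [Real.sqrt_nonneg B])
      (Real.sqrt_le_one.mpr (shrinkage_le_one V A))]
  have hcos : Real.cos φ = √(1 - B) := by
    rw [Real.cos_neg, Real.cos_arcsin, Real.sq_sqrt hB]
  have hA : √(A : ℝ) = √((V : ℝ) + A) * √(1 - B) := by
    rw [← Real.sqrt_mul (by positivity), add_mul_one_sub_shrinkage]
  have hV : √(V : ℝ) = √((V : ℝ) + A) * √B := by
    rw [← Real.sqrt_mul (by positivity), add_mul_shrinkage]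
  have hsq : √(1 - B) * √(1 - B) = 1 - B := Real.mul_self_sqrt hB'
  have hsq' : √B * √B = B := Real.mul_self_sqrt hB
  conv_lhs => rw [twoStageGaussian, ← IsGaussian.map_rotation_eq_self integral_id_stdGaussian φ,
    Measure.map_map (by fun_prop) (by fun_prop)]
  congr 1 with z : 1
  simp only [Function.comp_apply, ContinuousLinearMap.rotation_apply, hsin, hcos, hA, hV,
    Real.sqrt_mul hB, neg_neg]
  refine Prod.ext ?_ ?_
  · linear_combination (norm := module) (√((V : ℝ) + A) • hsq) • z.1
  · linear_combination (norm := module) (√((V : ℝ) + A) • (hsq + hsq')) • z.1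

variable (K : Submodule ℝ E) {μ : E} (V A : ℝ≥0) (u : E)

lemma memLp_inner_sub_jamesSteinToward_twoStageGaussian (hμ : μ ∈ K) (hK : 2 < finrank ℝ Kᗮ) :
    MemLp (fun z ↦ ⟪u, z.1 - jamesSteinToward K V z.2⟫) 2 (twoStageGaussian μ V A) := by
  rw [twoStageGaussian_eq_map_posterior,
    memLp_map_measure_iff (Measurable.aestronglyMeasurable (by fun_prop)) (by fun_prop)]
  simp_rw [Function.comp_def, posterior_sub_jamesSteinToward K hμ, inner_add_right,
    real_inner_smul_right]
  exact (((memLp_inner_jamesSteinToward_stdGaussian K u hK 1).const_mul _).comp_fst _).add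
    (((memLp_inner_stdGaussian u).const_mul _).comp_snd _)

lemma integral_inner_sub_jamesSteinToward_sq_twoStageGaussian (hμ : μ ∈ K)
    (hK : 2 < finrank ℝ Kᗮ) :
    ∫ z, ⟪u, z.1 - jamesSteinToward K V z.2⟫ ^ 2 ∂twoStageGaussian μ V A
      = V * (1 - shrinkage V A) * ‖u‖ ^ 2 + V * shrinkage V A * (‖K.starProjection u‖ ^ 2
        + 2 * ‖Kᗮ.starProjection u‖ ^ 2 / finrank ℝ Kᗮ) := by
  have hB := shrinkage_nonneg V A
  have hB' : 0 ≤ 1 - shrinkage V A := sub_nonneg.mpr (shrinkage_le_one V A)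
  have hmean (c : ℝ) : ∫ w, c * ⟪u, w⟫ ∂stdGaussian E = 0 := by
    rw [integral_const_mul]
    exact mul_eq_zero_of_right _ (integral_strongDual_stdGaussian (innerSL ℝ u))
  rw [twoStageGaussian_eq_map_posterior,
    integral_map (by fun_prop) (Measurable.aestronglyMeasurable (by fun_prop))]
  simp_rw [posterior_sub_jamesSteinToward K hμ, inner_add_right, real_inner_smul_right]
  rw [integral_prod_add_sq ((memLp_inner_jamesSteinToward_stdGaussian K u hK 1).const_mul _)
    ((memLp_inner_stdGaussian u).const_mul _) (hmean _)]
  simp_rw [mul_pow, integral_const_mul, integral_inner_jamesSteinToward_one_sq_stdGaussian K u hK,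
    integral_inner_sq_stdGaussian, neg_sq, mul_pow, Real.sq_sqrt (mul_nonneg hB hB'),
    Real.sq_sqrt (add_nonneg V.coe_nonneg A.coe_nonneg)]
  linear_combination (shrinkage V A * (‖K.starProjection u‖ ^ 2
    + 2 * ‖Kᗮ.starProjection u‖ ^ 2 / finrank ℝ Kᗮ) + (1 - shrinkage V A) * ‖u‖ ^ 2)
    * add_mul_shrinkage V A

end TwoStageGaussian

section Regression

variable {m p : ℕ} {X : Matrix (Fin m) (Fin p) ℝ}

/-- The column space of `X`, as a subspace of Euclidean space: the projection onto it is the least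
squares fit. -/
def columnSpace (X : Matrix (Fin m) (Fin p) ℝ) : Submodule ℝ (EuclideanSpace ℝ (Fin m)) :=
  X.mulVecLin.range.map (WithLp.linearEquiv 2 ℝ (Fin m → ℝ)).symm.toLinearMap

lemma toLp_mulVec_mem_columnSpace (X : Matrix (Fin m) (Fin p) ℝ) (b : Fin p → ℝ) :
    WithLp.toLp 2 (X *ᵥ b) ∈ columnSpace X :=
  ⟨_, ⟨b, rfl⟩, rfl⟩

lemma finrank_orthogonal_columnSpace (hX : X.rank = p) :
    (finrank ℝ (columnSpace X)ᗮ : ℝ) = m - p := by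
  have hK : finrank ℝ (columnSpace X) = p := (LinearEquiv.finrank_map_eq _ _).trans hX
  have hsum := (columnSpace X).finrank_add_finrank_orthogonal
  rw [finrank_euclideanSpace_fin, hK] at hsum
  exact eq_sub_of_add_eq' (by exact_mod_cast hsum)

lemma isUnit_det_transpose_mul_self (hX : X.rank = p) : IsUnit (Xᵀ * X).det := by
  rw [← Matrix.isUnit_iff_isUnit_det, ← Matrix.mulVec_surjective_iff_isUnit]
  have hrank : finrank ℝ (Xᵀ * X).mulVecLin.range = finrank ℝ (Fin p → ℝ) :=
    (Matrix.rank_transpose_mul_self X).trans (hX.trans (finrank_fin_fun ℝ).symm)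
  exact LinearMap.range_eq_top.mp (Submodule.eq_top_of_finrank_eq hrank)

lemma starProjection_columnSpace (hX : X.rank = p) (y : Fin m → ℝ) :
    (columnSpace X).starProjection (WithLp.toLp 2 y) = WithLp.toLp 2 (X *ᵥ betaHat X y) := by
  have hnormal : Xᵀ *ᵥ (y - X *ᵥ betaHat X y) = 0 := by
    rw [Matrix.mulVec_sub, betaHat, Matrix.mulVec_mulVec, Matrix.mulVec_mulVec,
      Matrix.mul_nonsing_inv _ (isUnit_det_transpose_mul_self hX), Matrix.one_mulVec, sub_self]
  refine Submodule.eq_starProjection_of_mem_of_inner_eq_zero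
    (toLp_mulVec_mem_columnSpace X _) ?_
  rintro _ ⟨_, ⟨b, rfl⟩, rfl⟩
  change ⟪WithLp.toLp 2 (y - X *ᵥ betaHat X y), WithLp.toLp 2 (X *ᵥ b)⟫ = 0
  rw [EuclideanSpace.inner_toLp_toLp, star_trivial, dotProduct_comm, Matrix.dotProduct_mulVec,
    ← Matrix.mulVec_transpose, hnormal, zero_dotProduct]

lemma toLp_thetaHatEB (hX : X.rank = p) (V : ℝ≥0) (y : Fin m → ℝ) :
    WithLp.toLp 2 (thetaHatEB X V y)
      = jamesSteinToward (columnSpace X) V (WithLp.toLp 2 y) := by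
  have hres : (columnSpace X)ᗮ.starProjection (WithLp.toLp 2 y)
      = WithLp.toLp 2 (y - X *ᵥ betaHat X y) := by
    rw [Submodule.starProjection_orthogonal_val, starProjection_columnSpace hX, WithLp.toLp_sub]
  rw [jamesSteinToward, starProjection_columnSpace hX, jamesStein, Submodule.coe_smul,
    Submodule.coe_norm, ← Submodule.starProjection_apply, hres, finrank_orthogonal_columnSpace hX,
    ← WithLp.toLp_smul, ← WithLp.toLp_add, thetaHatEB, shrinkageHatEB, residualSS]
  congr 1
  module

lemma norm_starProjection_columnSpace_single_sq (hX : X.rank = p) (i : Fin m) :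
    ‖(columnSpace X).starProjection (EuclideanSpace.single i 1)‖ ^ 2 = leverage X i := by
  rw [Submodule.starProjection_apply, ← Submodule.coe_norm,
    ← (columnSpace X).re_inner_starProjection_eq_normSq, RCLike.re_to_real]
  change ⟪(columnSpace X).starProjection (WithLp.toLp 2 (Pi.single i 1)), EuclideanSpace.single i 1⟫
    = _
  rw [starProjection_columnSpace hX, EuclideanSpace.inner_single_right, one_mul, betaHat,
    Matrix.mulVec_single_one]
  rfl

lemma norm_starProjection_orthogonal_columnSpace_single_sq (hX : X.rank = p) (i : Fin m) :
    ‖(columnSpace X)ᗮ.starProjection (EuclideanSpace.single i 1)‖ ^ 2 = 1 - leverage X i := by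
  have h := Submodule.norm_sq_eq_add_norm_sq_starProjection (EuclideanSpace.single i (1 : ℝ))
    (columnSpace X)
  rw [norm_starProjection_columnSpace_single_sq hX, PiLp.norm_single, norm_one,
    one_pow] at h
  exact eq_sub_of_add_eq' h.symm

lemma sum_leverage (hX : X.rank = p) : ∑ i, leverage X i = p := by
  have hlev (i : Fin m) : leverage X i = (X * ((Xᵀ * X)⁻¹ * Xᵀ)) i i := rfl
  calc ∑ i, leverage X i = (X * ((Xᵀ * X)⁻¹ * Xᵀ)).trace := Finset.sum_congr rfl fun i _ ↦ hlev i
    _ = p := by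
      rw [Matrix.trace_mul_comm, Matrix.mul_assoc,
        Matrix.nonsing_inv_mul _ (isUnit_det_transpose_mul_self hX), Matrix.trace_one,
        Fintype.card_fin]

lemma sum_one_sub_leverage (hX : X.rank = p) : ∑ i, (1 - leverage X i) = (m : ℝ) - p := by
  rw [Finset.sum_sub_distrib, sum_leverage hX, Finset.sum_const, Finset.card_univ,
    Fintype.card_fin, nsmul_one]

end Regression

section Model

lemma compProd_eq_map_prod {F G H : Type*} [MeasurableSpace F] [MeasurableSpace G]
    [MeasurableSpace H] {Q : Measure F} [SFinite Q] {ρ : Measure G} [SFinite ρ] {κ : Kernel F H}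
    [IsSFiniteKernel κ] {f : F → G → H} (hf : Measurable (Function.uncurry f))
    (hκ : ∀ x, κ x = ρ.map (f x)) :
    Q ⊗ₘ κ = (Q.prod ρ).map fun z ↦ (z.1, f z.1 z.2) := by
  have hpair : Measurable fun z : F × G ↦ (z.1, f z.1 z.2) := measurable_fst.prodMk hf
  ext s hs
  rw [Measure.compProd_apply hs, Measure.map_apply hpair hs, Measure.prod_apply (hpair hs)]
  refine lintegral_congr fun x ↦ ?_
  rw [hκ, Measure.map_apply hf.of_uncurry_left (measurable_prodMk_left hs)]
  rfl

lemma pi_gaussianReal_eq_map_stdGaussian {ι : Type*} [Fintype ι] (μ : ι → ℝ) (v : ℝ≥0) :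
    Measure.pi (fun i ↦ gaussianReal (μ i) v)
      = (stdGaussian (EuclideanSpace ℝ ι)).map fun z i ↦ μ i + √(v : ℝ) * z i := by
  have hcoord (i : ι) : (gaussianReal 0 1).map ((μ i + ·) ∘ (√(v : ℝ) * ·))
      = gaussianReal (μ i) v := by
    rw [← Measure.map_map (by fun_prop) (by fun_prop),
      gaussianReal_map_const_mul, gaussianReal_map_const_add, mul_zero, zero_add, mul_one]
    congr 1
    exact NNReal.eq (Real.sq_sqrt v.coe_nonneg)
  rw [← map_pi_eq_stdGaussian, Measure.map_map (by fun_prop) (by fun_prop)]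
  simp_rw [← hcoord]
  exact (Measure.pi_map_pi (f := fun i ↦ (μ i + ·) ∘ (√(v : ℝ) * ·)) fun i ↦ by fun_prop).symm

instance isMarkovKernel_samplingKernel (m : ℕ) (V : ℝ≥0) : IsMarkovKernel (samplingKernel m V) :=
  ⟨fun θ ↦ inferInstanceAs (IsProbabilityMeasure (Measure.pi fun i ↦ gaussianReal (θ i) V))⟩

variable {Ω : Type*} [MeasurableSpace Ω] {P : Measure Ω} {m p : ℕ}
  {X : Matrix (Fin m) (Fin p) ℝ} {β : Fin p → ℝ} {V A : ℝ≥0} {θ y : Ω → Fin m → ℝ}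

lemma map_compProd_samplingKernel (X : Matrix (Fin m) (Fin p) ℝ) (β : Fin p → ℝ) (V A : ℝ≥0) :
    (linkingLaw X β A ⊗ₘ samplingKernel m V).map (Prod.map (WithLp.toLp 2) (WithLp.toLp 2))
      = twoStageGaussian (WithLp.toLp 2 (X *ᵥ β)) V A := by
  have hlink : linkingLaw X β A = (stdGaussian (EuclideanSpace ℝ (Fin m))).map
      fun z i ↦ (X *ᵥ β) i + √(A : ℝ) * z i := pi_gaussianReal_eq_map_stdGaussian _ A
  have hprod := Measure.map_prod_map (stdGaussian (EuclideanSpace ℝ (Fin m)))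
    (stdGaussian (EuclideanSpace ℝ (Fin m)))
    (f := fun z i ↦ (X *ᵥ β) i + √(A : ℝ) * z i) (by fun_prop) measurable_id
  rw [Measure.map_id] at hprod
  rw [hlink, compProd_eq_map_prod (ρ := stdGaussian (EuclideanSpace ℝ (Fin m)))
    (f := fun θ z i ↦ θ i + √(V : ℝ) * z i) (by fun_prop)
    fun θ ↦ pi_gaussianReal_eq_map_stdGaussian θ V, hprod,
    Measure.map_map (by fun_prop) (by fun_prop), Measure.map_map (by fun_prop) (by fun_prop),
    twoStageGaussian]
  rfl

lemma IsAreaLevelModel.hasLaw_toLp (h : IsAreaLevelModel P X β V A θ y) :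
    HasLaw (fun ω ↦ (WithLp.toLp 2 (θ ω), WithLp.toLp 2 (y ω)))
      (twoStageGaussian (WithLp.toLp 2 (X *ᵥ β)) V A) P :=
  HasLaw.comp ⟨by fun_prop, map_compProd_samplingKernel X β V A⟩
    (h.law_theta.prodMk_of_hasCondDistrib h.law_y_given_theta)

lemma IsAreaLevelModel.mse_thetaHatEB (h : IsAreaLevelModel P X β V A θ y) (hmp : p + 2 < m)
    (hX : X.rank = p) (i : Fin m) :
    Integrable (fun ω ↦ (θ ω i - thetaHatEB X V (y ω) i) ^ 2) P ∧
      ∫ ω, (θ ω i - thetaHatEB X V (y ω) i) ^ 2 ∂P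
        = V * (1 - shrinkage V A) + V * shrinkage V A * leverage X i
          + 2 * V * shrinkage V A * (1 - leverage X i) / ((m : ℝ) - p) := by
  have hK : 2 < finrank ℝ (columnSpace X)ᗮ := by
    have hdim : (2 : ℝ) < m - p := lt_sub_iff_add_lt'.mpr (by exact_mod_cast hmp)
    rw [← finrank_orthogonal_columnSpace hX] at hdim
    exact_mod_cast hdim
  have hμ := toLp_mulVec_mem_columnSpace X β
  have herror (ω : Ω) : (θ ω i - thetaHatEB X V (y ω) i) ^ 2
      = ⟪EuclideanSpace.single i (1 : ℝ), WithLp.toLp 2 (θ ω)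
        - jamesSteinToward (columnSpace X) V (WithLp.toLp 2 (y ω))⟫ ^ 2 := by
    rw [← toLp_thetaHatEB hX, EuclideanSpace.inner_single_left, map_one, one_mul]
    rfl
  have hint := (memLp_inner_sub_jamesSteinToward_twoStageGaussian (columnSpace X) V A
    (EuclideanSpace.single i (1 : ℝ)) hμ hK).integrable_sq
  simp_rw [herror]
  refine ⟨?_, ?_⟩
  · rw [← h.hasLaw_toLp.map_eq] at hint
    exact hint.comp_aemeasurable h.hasLaw_toLp.aemeasurable
  · refine (h.hasLaw_toLp.integral_comp hint.aestronglyMeasurable).trans ?_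
    rw [integral_inner_sub_jamesSteinToward_sq_twoStageGaussian _ V A _ hμ hK,
      PiLp.norm_single, norm_starProjection_columnSpace_single_sq hX,
      norm_starProjection_orthogonal_columnSpace_single_sq hX, finrank_orthogonal_columnSpace hX,
      norm_one]
    ring

end Model

end AreaLevel

theorem theorem3 {Ω : Type*} [MeasurableSpace Ω] (P : Measure Ω) [IsProbabilityMeasure P]
    (m p : ℕ) (hmp : p + 2 < m)
    (X : Matrix (Fin m) (Fin p) ℝ) (hX : X.rank = p) (β : Fin p → ℝ)
    (V A : ℝ≥0) (hV : 0 < V)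
    (θ y : Ω → Fin m → ℝ) (hmodel : AreaLevel.IsAreaLevelModel P X β V A θ y) :
    (∀ i : Fin m,
      Integrable (fun ω => (θ ω i - AreaLevel.thetaHatEB X V (y ω) i) ^ 2) P ∧
      ∫ ω, (θ ω i - AreaLevel.thetaHatEB X V (y ω) i) ^ 2 ∂P =
        V * (1 - AreaLevel.shrinkage V A)
          + V * AreaLevel.shrinkage V A * AreaLevel.leverage X i
          + 2 * V * AreaLevel.shrinkage V A * (1 - AreaLevel.leverage X i) / ((m : ℝ) - p)) ∧
    (Integrable (fun ω => ‖WithLp.toLp 2 (θ ω - AreaLevel.thetaHatEB X V (y ω))‖ ^ 2) P ∧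
      ∫ ω, ‖WithLp.toLp 2 (θ ω - AreaLevel.thetaHatEB X V (y ω))‖ ^ 2 ∂P =
        V * ((m : ℝ) - ((m : ℝ) - p - 2) * AreaLevel.shrinkage V A)) := by
  have hmse := hmodel.mse_thetaHatEB hmp hX
  refine ⟨hmse, ?_⟩
  have hsum (ω : Ω) : ‖WithLp.toLp 2 (θ ω - AreaLevel.thetaHatEB X V (y ω))‖ ^ 2
      = ∑ i, (θ ω i - AreaLevel.thetaHatEB X V (y ω) i) ^ 2 :=
    EuclideanSpace.real_norm_sq_eq _
  simp_rw [hsum]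
  refine ⟨integrable_finsetSum _ fun i _ ↦ (hmse i).1, ?_⟩
  have hmp' : (p : ℝ) + 2 < m := by exact_mod_cast hmp
  have hdim : (m : ℝ) - p ≠ 0 := by linarith
  rw [integral_finsetSum _ fun i _ ↦ (hmse i).1, Finset.sum_congr rfl fun i _ ↦ (hmse i).2,
    Finset.sum_add_distrib, Finset.sum_add_distrib, ← Finset.sum_div, ← Finset.mul_sum,
    ← Finset.mul_sum, ← Finset.mul_sum, AreaLevel.sum_one_sub_leverage hX,
    AreaLevel.sum_leverage hX]
  simp only [Finset.sum_const, Finset.card_univ, Fintype.card_fin, nsmul_eq_mul]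
  field_simp
  ring
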